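/- Let $\ell\ge 1$ be an integer, let $\Delta=\{1,\dots,\ell\}^2$ with points $(x,i)$ ($i$ labels the horizontal layers), and let $\lambda>0$. For $\sigma\in\{-1,1\}^{\Delta}$ set $$H^{\rm vert}_\ell(\sigma)=-\lambda\sum_{x=1}^{\ell}\sum_{i=1}^{\ell}\sigma(x,i)\,\sigma(x,i+1),\qquad \sigma(x,\ell+1):=\sigma(x,1).$$ For $\underline h=(h_1,\dots,h_\ell)\in\mathbb R^\ell$ set $$Z_{\Delta,\underline h}=\sum_{\sigma\in\{-1,1\}^\Delta}e^{-H^{\rm vert}_\ell(\sigma)+\sum_{(x,i)\in\Delta}h_i\sigma(x,i)},\qquad Z_{\ell,\underline h}=\sum_{\sigma\in\{-1,1\}^{\ell}}e^{\sum_{i=1}^\ell\{\lambda\sigma(i)\sigma(i+1)+h_i\sigma(i)\}},\quad \sigma(\ell+1):=\sigma(1).$$ Let $\mathcal M_\ell=\{-1,-1+\frac2\ell,\dots,1-\frac2\ell,1\}$ and, for $\underline m=(m_1,\dots,m_\ell)\in\mathcal M_\ell^{\,\ell}$, define the free energy with the magnetization fixed on each layer, $$\phi_\ell(\underline m)=-\frac1{\ell^2}\log\sum_{\sigma\in\{-1,1\}^\Delta}e^{-H^{\rm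 vert}_\ell(\sigma)}\,\mathbf 1\Big\{\sum_{x=1}^{\ell}\sigma(x,i)=\ell\, m_i\ \text{ for all } i\Big\}.$$ **Theorem.** Let $m_+\in(0,1)$. For every $\lambda>0$ small enough (depending only on $m_+$) the following holds. For every $\ell\ge1$ and every $\underline m\in\mathbb R^\ell$ with $|m_i|\le m_+$ for $i=1,\dots,\ell$ there is a unique $\underline h\in\mathbb R^\ell$ (the field associated to $\underline m$) such that $$m_i=\frac{\partial}{\partial h_i}\log Z_{\ell,\underline h},\qquad i=1,\dots,\ell .$$ Moreover, for every $a\in(\frac12,1)$ there is a constant $c$ (depending only on $m_+,\lambda,a$) such that for every $\ell\ge1$ and every $\underline m\in\mathcal M_\ell^{\,\ell}$ with $|m_i|\le m_+$ for all $i$, with $\underline h$ the field associated to $\underline m$, $$\Big|\frac1{\ell^2}\log\Big\{e^{-\ell\sum_{i}h_im_i}Z_{\Delta,\underline h}\Big\}+\phi_\ell(\underline m)\Big|\le c\,\ell^{a-1}.$$ -/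

import Mathlib

noncomputable section

namespace LayerIsing

/-- The real value `±1` of a spin; a spin is an element of `ℤˣ = {1, -1}`. -/
def spin (s : ℤˣ) : ℝ := ((s : ℤ) : ℝ)

/-- The vertical Hamiltonian in the square `Δ` of side `ℓ` with periodic vertical boundary
conditions: `- lam ∑_{x,i} σ(x,i) σ(x,i+1)`, where `σ(x,ℓ+1) = σ(x,1)` (addition in `Fin ℓ` is
cyclic). The first argument of `σ` is the horizontal coordinate `x`, the second the layer `i`. -/
def Hvert {ℓ : ℕ} [NeZero ℓ] (lam : ℝ) (σ : Fin ℓ → Fin ℓ → ℤˣ) : ℝ :=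
  ∑ x, (-lam * ∑ i, spin (σ x i) * spin (σ x (i + 1)))

/-- The multi-gran-canonical partition function in the square `Δ`, with a magnetic field `h i`
on the layer `i`. -/
def Zsquare {ℓ : ℕ} [NeZero ℓ] (lam : ℝ) (h : Fin ℓ → ℝ) : ℝ :=
  ∑ σ : Fin ℓ → Fin ℓ → ℤˣ,
    Real.exp (-Hvert lam σ + ∑ x, ∑ i, h i * spin (σ x i))

/-- The partition function of the one-dimensional periodic Ising model on `{1,…,ℓ}` with nearest
neighbour coupling `lam` and site dependent magnetic field `h`. -/
def Zcolumn {ℓ : ℕ} [NeZero ℓ] (lam : ℝ) (h : Fin ℓ → ℝ) : ℝ :=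
  ∑ σ : Fin ℓ → ℤˣ,
    Real.exp (∑ i, (lam * spin (σ i) * spin (σ (i + 1)) + h i * spin (σ i)))

/-- `h` is a field associated to the layer magnetizations `m`: for every `i`, the partial
derivative `∂ log Zcolumn / ∂ h_i` at `h` exists and equals `m i`. -/
def IsAssociatedField {ℓ : ℕ} [NeZero ℓ] (lam : ℝ) (m h : Fin ℓ → ℝ) : Prop :=
  ∀ i, HasDerivAt (fun t : ℝ => Real.log (Zcolumn lam (Function.update h i t))) (m i) (h i)

/-- The possible values `-1, -1 + 2/ℓ, …, 1 - 2/ℓ, 1` of the empirical magnetization of a layer. -/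
def magValues (ℓ : ℕ) : Set ℝ :=
  {r | ∃ k : ℕ, k ≤ ℓ ∧ r = -1 + 2 * (k : ℝ) / (ℓ : ℝ)}

/-- The constrained (multi-canonical) partition function: the magnetization of every layer `i`
is fixed to be `m i`, that is `∑_x σ(x,i) = ℓ m_i`. -/
def Zconstrained {ℓ : ℕ} [NeZero ℓ] (lam : ℝ) (m : Fin ℓ → ℝ) : ℝ :=
  ∑ σ : Fin ℓ → Fin ℓ → ℤˣ,
    if ∀ i, ∑ x, spin (σ x i) = (ℓ : ℝ) * m i then Real.exp (-Hvert lam σ) else 0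

/-- The constrained free energy per site, `φ_ℓ(m) = - |Δ|⁻¹ log Zconstrained` with `|Δ| = ℓ²`. -/
def phi {ℓ : ℕ} [NeZero ℓ] (lam : ℝ) (m : Fin ℓ → ℝ) : ℝ :=
  -(1 / (ℓ : ℝ) ^ 2) * Real.log (Zconstrained lam m)

end LayerIsing

end

namespace LayerIsing

open Finset

/-! The field is the critical point of the strictly convex function `log Zcolumn - ∑ h i * m i`,
which is coercive because `mplus < 1` (`exists_isAssociatedField`, `isAssociatedField_unique`). In
that field the columns of the square are independent and layer `i` has mean magnetization `m i`. The
constrained configurations form part of `Zsquare`, and on them the field term is constant, which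
gives one inequality. For the converse, the layer magnetizations deviate from their targets by `O(ℓ
^ (3/2))` in total on average, by a second moment bound. Flipping that many spins restores the
constraint, each flip costing a bounded factor since the field is bounded uniformly in `ℓ`
(`abs_field_le`). The number of configurations corrected to the same one is controlled by a penalty
`exp (-κ)` per flip with `κ = 2 log ℓ` (`Zsquare_mul_exp_le`). The logarithms then differ by `O(ℓ ^
(3/2) log ℓ)`, which after division by `ℓ ^ 2` is `O(ℓ ^ (a - 1))`. -/

lemma spin_eq_one_or (s : ℤˣ) : spin s = 1 ∨ spin s = -1 := by
  rcases Int.units_eq_one_or s with rfl | rfl <;> simp [spin]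

lemma spin_neg (s : ℤˣ) : spin (-s) = -spin s := by simp [spin]

lemma abs_spin (s : ℤˣ) : |spin s| = 1 := by
  rcases spin_eq_one_or s with h | h <;> simp [h]

/-- The energy exponent of a single column in the field `h`. -/
noncomputable def columnExponent {ℓ : ℕ} [NeZero ℓ] (lam : ℝ) (h : Fin ℓ → ℝ)
    (σ : Fin ℓ → ℤˣ) : ℝ :=
  ∑ i, (lam * spin (σ i) * spin (σ (i + 1)) + h i * spin (σ i))

/-- Half the `ℓ¹` distance of two spin configurations, that is their Hamming distance. -/
noncomputable def spinDist {α : Type*} [Fintype α] (σ τ : α → ℤˣ) : ℝ :=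
  ∑ i, |spin (σ i) - spin (τ i)| / 2

/-! ### One column: existence, uniqueness and boundedness of the associated field. -/

section Column

variable {ℓ : ℕ} [NeZero ℓ] {lam : ℝ} {h m : Fin ℓ → ℝ}

lemma Zcolumn_eq : Zcolumn lam h = ∑ σ, Real.exp (columnExponent lam h σ) := rfl

lemma Zcolumn_pos : 0 < Zcolumn lam h :=
  sum_pos (fun _ _ => Real.exp_pos _) univ_nonempty

lemma columnExponent_eq_add (σ : Fin ℓ → ℤˣ) (h' : Fin ℓ → ℝ) :
    columnExponent lam h' σ = columnExponent lam h σ + ∑ i, (h' i - h i) * spin (σ i) := by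
  simp only [columnExponent, ← sum_add_distrib]
  exact sum_congr rfl fun i _ => by ring

lemma columnExponent_update (σ : Fin ℓ → ℤˣ) (i : Fin ℓ) (t : ℝ) :
    columnExponent lam (Function.update h i t) σ
      = columnExponent lam h σ + (t - h i) * spin (σ i) := by
  rw [columnExponent_eq_add (h := h)]
  congr 1
  rw [sum_eq_single i] <;> simp +contextual [Function.update_of_ne]

/-- A flip changes two bonds by at most `2 * lam` each and the field term by at most `2 * H`. -/
lemma abs_columnExponent_sub_le (hlam : 0 ≤ lam) {H : ℝ} (hH : ∀ i, |h i| ≤ H)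
    (σ τ : Fin ℓ → ℤˣ) :
    |columnExponent lam h σ - columnExponent lam h τ| ≤ (4 * lam + 2 * H) * spinDist σ τ := by
  have hshift : ∑ i, |spin (σ (i + 1)) - spin (τ (i + 1))| = ∑ i, |spin (σ i) - spin (τ i)| :=
    Equiv.sum_comp (Equiv.addRight (1 : Fin ℓ)) fun i => |spin (σ i) - spin (τ i)|
  calc |columnExponent lam h σ - columnExponent lam h τ|
      ≤ ∑ i, (lam * |spin (σ i) - spin (τ i)| + lam * |spin (σ (i + 1)) - spin (τ (i + 1))|
          + H * |spin (σ i) - spin (τ i)|) := by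
        simp only [columnExponent, ← sum_sub_distrib]
        refine (abs_sum_le_sum_abs _ _).trans (sum_le_sum fun i _ => ?_)
        have e : lam * spin (σ i) * spin (σ (i + 1)) + h i * spin (σ i)
            - (lam * spin (τ i) * spin (τ (i + 1)) + h i * spin (τ i))
            = lam * (spin (σ i) - spin (τ i)) * spin (σ (i + 1))
              + lam * (spin (σ (i + 1)) - spin (τ (i + 1))) * spin (τ i)
              + h i * (spin (σ i) - spin (τ i)) := by ring
        rw [e]
        refine (abs_add_three _ _ _).trans ?_
        simp only [abs_mul, abs_spin, mul_one, abs_of_nonneg hlam]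
        gcongr
        exact hH i
    _ = (4 * lam + 2 * H) * spinDist σ τ := by
        simp only [sum_add_distrib, ← mul_sum, hshift, spinDist, ← sum_div]
        ring

lemma hasDerivAt_log_Zcolumn (i : Fin ℓ) :
    HasDerivAt (fun t : ℝ => Real.log (Zcolumn lam (Function.update h i t)))
      ((∑ σ, Real.exp (columnExponent lam h σ) * spin (σ i)) / Zcolumn lam h) (h i) := by
  have hZ : HasDerivAt (fun t : ℝ => Zcolumn lam (Function.update h i t))
      (∑ σ, Real.exp (columnExponent lam h σ) * spin (σ i)) (h i) := by
    simp only [Zcolumn_eq, columnExponent_update]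
    refine HasDerivAt.fun_sum fun σ _ => ?_
    have := ((((hasDerivAt_id (h i)).sub_const (h i)).mul_const (spin (σ i))).const_add
      (columnExponent lam h σ)).exp
    simpa using this
  have := hZ.log (by simpa using (Zcolumn_pos (lam := lam) (h := h)).ne')
  simpa using this

lemma isAssociatedField_iff :
    IsAssociatedField lam m h ↔
      ∀ i, ∑ σ, Real.exp (columnExponent lam h σ) * (spin (σ i) - m i) = 0 := by
  refine forall_congr' fun i => ?_
  have key : ∑ σ, Real.exp (columnExponent lam h σ) * (spin (σ i) - m i) = 0 ↔
      (∑ σ, Real.exp (columnExponent lam h σ) * spin (σ i)) / Zcolumn lam h = m i := by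
    rw [div_eq_iff Zcolumn_pos.ne', Zcolumn_eq]
    simp only [mul_sub, sum_sub_distrib, sub_eq_zero, ← sum_mul]
    rw [mul_comm (m i)]
  rw [key]
  exact ⟨fun H => (hasDerivAt_log_Zcolumn i).unique H, fun H => H ▸ hasDerivAt_log_Zcolumn i⟩

/-- Strict convexity of `log Zcolumn` along the segment from `h` to `h'`: the centred increment `u`
has mean zero in both fields, so `u * (exp u - 1)`, which is nonnegative, has mean zero and `u`
vanishes identically. -/
lemma isAssociatedField_unique {h' : Fin ℓ → ℝ} (H : IsAssociatedField lam m h)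
    (H' : IsAssociatedField lam m h') : h' = h := by
  rw [isAssociatedField_iff] at H H'
  set u : (Fin ℓ → ℤˣ) → ℝ := fun σ => ∑ i, (h' i - h i) * (spin (σ i) - m i) with hu
  set C : ℝ := ∑ i, (h' i - h i) * m i with hC
  have hE : ∀ σ, columnExponent lam h' σ = columnExponent lam h σ + u σ + C := fun σ => by
    rw [columnExponent_eq_add (h := h), add_assoc]
    simp only [hu, hC, ← sum_add_distrib]
    congr 1
    exact sum_congr rfl fun i _ => by ring
  have mean_zero : ∀ g : Fin ℓ → ℝ,
      (∀ i, ∑ σ, Real.exp (columnExponent lam g σ) * (spin (σ i) - m i) = 0) →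
      ∑ σ, Real.exp (columnExponent lam g σ) * u σ = 0 := fun g hg => by
    simp only [hu, mul_sum]
    rw [sum_comm]
    refine sum_eq_zero fun i _ => ?_
    rw [← mul_zero (h' i - h i), ← hg i, mul_sum]
    exact sum_congr rfl fun σ _ => by ring
  have h1 := mean_zero h H
  have h2 := mean_zero h' H'
  have h3 : ∑ σ, Real.exp (columnExponent lam h σ) * (u σ * (Real.exp (u σ) - 1)) = 0 := by
    have h4 : Real.exp C * ∑ σ, Real.exp (columnExponent lam h σ) * (u σ * Real.exp (u σ)) = 0 := by
      rw [← h2, mul_sum]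
      refine sum_congr rfl fun σ _ => ?_
      rw [hE, Real.exp_add, Real.exp_add]
      ring
    have h5 := (mul_eq_zero.mp h4).resolve_left (Real.exp_pos _).ne'
    simp only [mul_sub, mul_one, sum_sub_distrib, h1, h5, sub_zero]
  have hnn : ∀ x : ℝ, 0 ≤ x * (Real.exp x - 1) := fun x => by
    rcases le_total 0 x with hx | hx
    · exact mul_nonneg hx (by linarith [Real.one_le_exp hx])
    · exact mul_nonneg_of_nonpos_of_nonpos hx (by linarith [Real.exp_le_one_iff.mpr hx])
  have hu0 : ∀ σ, u σ = 0 := fun σ => by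
    have h6 := (sum_eq_zero_iff_of_nonneg fun σ _ =>
      mul_nonneg (Real.exp_pos (columnExponent lam h σ)).le (hnn (u σ))).mp h3 σ (mem_univ σ)
    rcases mul_eq_zero.mp ((mul_eq_zero.mp h6).resolve_left (Real.exp_pos _).ne') with h7 | h7
    · exact h7
    · exact Real.exp_eq_one_iff _ |>.mp (by linarith)
  funext i
  -- Two configurations differing only at `i` isolate the `i`-th coordinate.
  have h8 : u 1 - u (Function.update 1 i (-1)) = (h' i - h i) * 2 := by
    simp only [hu, ← sum_sub_distrib]
    rw [sum_eq_single i]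
    · simp [spin]; ring
    · intro j _ hj
      simp [Function.update_of_ne hj]
    · simp
  rw [hu0, hu0] at h8
  linarith

lemma exists_isAssociatedField {mplus : ℝ} (h1 : mplus < 1) (hm : ∀ i, |m i| ≤ mplus) :
    ∃ h, IsAssociatedField lam m h := by
  set F : (Fin ℓ → ℝ) → ℝ := fun h => Real.log (Zcolumn lam h) - ∑ i, h i * m i with hF
  have hcont : Continuous F := by
    refine Continuous.sub (Continuous.log ?_ fun h => Zcolumn_pos.ne') (by fun_prop)
    unfold Zcolumn
    fun_prop
  have hlow : ∀ h : Fin ℓ → ℝ, (1 - mplus) * ‖h‖ - |lam| * ℓ ≤ F h := fun h => by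
    -- Coercivity: the single configuration aligned with `h` already contributes `∑ |h i|` to the
    -- exponent, up to the couplings.
    set σ : Fin ℓ → ℤˣ := fun i => if 0 ≤ h i then 1 else -1 with hσ
    have hs : ∀ i, h i * spin (σ i) = |h i| := fun i => by
      by_cases hi : 0 ≤ h i
      · simp [hσ, hi, spin, abs_of_nonneg hi]
      · simp [hσ, hi, spin, abs_of_neg (not_le.mp hi)]
    have hlog : columnExponent lam h σ ≤ Real.log (Zcolumn lam h) := by
      rw [Real.le_log_iff_exp_le Zcolumn_pos, Zcolumn_eq]
      exact single_le_sum (f := fun σ => Real.exp (columnExponent lam h σ))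
        (fun _ _ => (Real.exp_pos _).le) (mem_univ σ)
    have hsum : ∑ i, ((1 - mplus) * |h i| - |lam|) ≤ columnExponent lam h σ - ∑ i, h i * m i := by
      rw [columnExponent, ← sum_sub_distrib]
      refine sum_le_sum fun i _ => ?_
      have h2 : -|lam| ≤ lam * spin (σ i) * spin (σ (i + 1)) := by
        have := neg_abs_le (lam * spin (σ i) * spin (σ (i + 1)))
        simpa [abs_mul, abs_spin] using this
      have h3 : h i * m i ≤ |h i| * mplus := by
        refine (le_abs_self _).trans ?_
        rw [abs_mul]
        gcongr
        exact hm i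
      rw [hs]
      linarith
    have hnorm : ‖h‖ ≤ ∑ i, |h i| :=
      (pi_norm_le_iff_of_nonneg (sum_nonneg fun i _ => abs_nonneg _)).mpr fun i =>
        single_le_sum (f := fun i => |h i|) (fun _ _ => abs_nonneg _) (mem_univ i)
    have h4 := mul_le_mul_of_nonneg_left hnorm (sub_nonneg.mpr h1.le)
    simp only [sum_sub_distrib, ← mul_sum, sum_const, card_univ, Fintype.card_fin,
      nsmul_eq_mul] at hsum
    simp only [hF]
    linarith
  have hlim : Filter.Tendsto F (Filter.cocompact _) Filter.atTop := by
    refine Filter.tendsto_atTop_mono hlow ?_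
    exact Filter.tendsto_atTop_add_const_right _ _
      ((tendsto_norm_cocompact_atTop).const_mul_atTop (sub_pos.mpr h1))
  obtain ⟨h, hmin⟩ := hcont.exists_forall_le hlim
  refine ⟨h, fun i => ?_⟩
  have hd := hasDerivAt_log_Zcolumn (lam := lam) (h := h) i
  have hlin : HasDerivAt (fun t : ℝ => ∑ j, Function.update h i t j * m j) (m i) (h i) := by
    have e : (fun t : ℝ => ∑ j, Function.update h i t j * m j)
        = fun t => t * m i + ∑ j ∈ univ.erase i, h j * m j := by
      funext t
      rw [← add_sum_erase _ _ (mem_univ i), Function.update_self]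
      congr 1
      exact sum_congr rfl fun j hj => by rw [Function.update_of_ne (ne_of_mem_erase hj)]
    rw [e]
    simpa using ((hasDerivAt_id (h i)).mul_const (m i)).add_const
      (∑ j ∈ univ.erase i, h j * m j)
  have hcrit : IsLocalMin (fun t : ℝ => F (Function.update h i t)) (h i) :=
    Filter.Eventually.of_forall fun t => by
      simpa using hmin (Function.update h i t)
  have h0 := hcrit.hasDerivAt_eq_zero (hd.sub hlin)
  rw [sub_eq_zero] at h0
  exact h0 ▸ hd

/-- Flipping one spin bounds the field from above by its magnetization. -/
lemma exp_field_le (hlam : 0 ≤ lam) {i : Fin ℓ} (hmi : |m i| < 1) (ε : ℤˣ)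
    (H : ∑ σ, Real.exp (columnExponent lam h σ) * (spin (σ i) - m i) = 0) :
    Real.exp (2 * (spin ε * h i) - 4 * lam) * (1 - |m i|) ≤ 2 := by
  by_contra! hcon
  set flip : (Fin ℓ → ℤˣ) → Fin ℓ → ℤˣ := fun σ => Function.update σ i (-σ i) with hflip
  have hinv : Function.Involutive flip := fun σ => by simp [hflip]
  have hmabs := abs_lt.mp hmi
  have hma := neg_abs_le (m i)
  have hmb := le_abs_self (m i)
  -- Comparing at zero field first separates the coupling cost, at most `4 * lam`, from the exact
  -- field gain.
  have hdrop : ∀ σ, σ i = ε → Real.exp (2 * (spin ε * h i) - 4 * lam)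
      * Real.exp (columnExponent lam h (flip σ)) ≤ Real.exp (columnExponent lam h σ) := by
    intro σ hσ
    rw [← Real.exp_add, Real.exp_le_exp]
    have hd : spinDist σ (flip σ) = 1 := by
      rw [spinDist, sum_eq_single i]
      · rcases spin_eq_one_or (σ i) with h' | h' <;> simp [hflip, spin_neg, h'] <;> norm_num
      · intro j _ hj
        simp [hflip, Function.update_of_ne hj]
      · simp
    have hl := (abs_le.mp (abs_columnExponent_sub_le (h := 0) hlam (H := 0) (by simp)
      σ (flip σ))).1
    rw [hd] at hl
    have hfield : ∑ j, h j * spin (σ j) - ∑ j, h j * spin (flip σ j) = 2 * (spin ε * h i) := by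
      rw [← sum_sub_distrib, sum_eq_single i]
      · simp [hflip, spin_neg, hσ]; ring
      · intro j _ hj
        simp [hflip, Function.update_of_ne hj]
      · simp
    rw [columnExponent_eq_add (h := 0) σ h, columnExponent_eq_add (h := 0) (flip σ) h]
    simp only [Pi.zero_apply, sub_zero]
    linarith
  -- With weights `q` (spin `ε`) and `p` (flipped), a pair contributes at least `q * (1 - |m i|) - p
  -- * (1 + |m i|)`, and `hcon` makes the first term exceed `2 * p`. So the mean could not vanish.
  have hpair : ∀ σ, 0 < spin ε * (Real.exp (columnExponent lam h σ) * (spin (σ i) - m i)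
      + Real.exp (columnExponent lam h (flip σ)) * (spin (flip σ i) - m i)) := by
    have aux : ∀ σ, σ i = ε → 0 < spin ε * (Real.exp (columnExponent lam h σ) * (spin (σ i) - m i)
      + Real.exp (columnExponent lam h (flip σ)) * (spin (flip σ i) - m i)) := by
      intro σ hσ
      have hfi : spin (flip σ i) = -spin ε := by simp [hflip, spin_neg, hσ]
      rw [hfi, hσ]
      have hp := Real.exp_pos (columnExponent lam h (flip σ))
      have hq := Real.exp_pos (columnExponent lam h σ)
      have h1 := mul_le_mul_of_nonneg_right (hdrop σ hσ) (sub_nonneg.mpr hmi.le)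
      have h2 := mul_lt_mul_of_pos_right hcon hp
      have h3 := mul_le_mul_of_nonneg_left hma hq.le
      have h4 := mul_le_mul_of_nonneg_left hmb hq.le
      have h5 := mul_le_mul_of_nonneg_left hmabs.1.le hp.le
      have h6 := mul_le_mul_of_nonneg_left hmabs.2.le hp.le
      rcases spin_eq_one_or ε with h' | h' <;> rw [h'] at * <;> nlinarith
    intro σ
    rcases eq_or_ne (σ i) ε with hσ | hσ
    · exact aux σ hσ
    · have hσ' : flip σ i = ε := by
        simp only [hflip, Function.update_self]
        exact neg_eq_iff_eq_neg.mpr (Int.units_ne_iff_eq_neg.mp hσ)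
      have := aux (flip σ) hσ'
      rw [hinv σ] at this
      rwa [add_comm]
  have hsum : ∑ σ, (Real.exp (columnExponent lam h σ) * (spin (σ i) - m i)
      + Real.exp (columnExponent lam h (flip σ)) * (spin (flip σ i) - m i)) = 0 := by
    rw [sum_add_distrib, H, zero_add, ← H]
    exact Equiv.sum_comp hinv.toPerm
      fun σ => Real.exp (columnExponent lam h σ) * (spin (σ i) - m i)
  have := sum_pos (fun σ _ => hpair σ) (univ_nonempty (α := Fin ℓ → ℤˣ))
  rw [← mul_sum, hsum, mul_zero] at this
  exact this.false

/-- The bound is free of `ℓ` and `m`, which makes the final constant uniform. -/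
lemma abs_field_le (hlam : 0 ≤ lam) {mplus : ℝ} (h1 : mplus < 1) (hm : ∀ i, |m i| ≤ mplus)
    (H : IsAssociatedField lam m h) (i : Fin ℓ) :
    |h i| ≤ 2 * lam + Real.log (2 / (1 - mplus)) / 2 := by
  rw [isAssociatedField_iff] at H
  have key : ∀ ε : ℤˣ, spin ε * h i ≤ 2 * lam + Real.log (2 / (1 - mplus)) / 2 := fun ε => by
    have h2 := exp_field_le hlam ((hm i).trans_lt h1) ε (H i)
    have h3 : Real.exp (2 * (spin ε * h i) - 4 * lam) ≤ 2 / (1 - mplus) := by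
      rw [le_div_iff₀ (sub_pos.mpr h1)]
      refine le_trans ?_ h2
      gcongr
      exact hm i
    have h4 := (Real.le_log_iff_exp_le (by have := sub_pos.mpr h1; positivity)).mpr h3
    linarith
  refine abs_le.mpr ⟨?_, ?_⟩
  · have := key (-1)
    simp [spin] at this
    linarith
  · simpa [spin] using key 1

end Column

/-! ### Second moments under product weights, and Jensen's inequality. -/

section Product

/-- The second moment of a sum of centred functions of independent variables. -/
lemma sum_prod_mul_sum_sq_le {β : Type*} [Fintype β] {n : ℕ} (w f : β → ℝ) (hw : ∀ b, 0 ≤ w b)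
    {B : ℝ} (hB : ∀ b, f b ^ 2 ≤ B) (hf : ∑ b, w b * f b = 0) :
    ∑ σ : Fin n → β, (∏ x, w (σ x)) * (∑ x, f (σ x)) ^ 2
      ≤ n * B * ∑ σ : Fin n → β, ∏ x, w (σ x) := by
  classical
  have hoff : ∀ x y : Fin n, x ≠ y →
      ∑ σ : Fin n → β, (∏ z, w (σ z)) * (f (σ x) * f (σ y)) = 0 := by
    intro x y hxy
    have e : ∀ σ : Fin n → β, (∏ z, w (σ z)) * (f (σ x) * f (σ y))
        = ∏ z, w (σ z) * ((if z = x then f (σ z) else 1) * if z = y then f (σ z) else 1) :=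
      fun σ => by
        rw [prod_mul_distrib, prod_mul_distrib, prod_ite_eq' , prod_ite_eq']
        simp
    simp only [e]
    rw [← Fintype.prod_sum
      (fun z b => w b * ((if z = x then f b else 1) * if z = y then f b else 1))]
    refine prod_eq_zero (mem_univ x) ?_
    simpa [hxy] using hf
  calc ∑ σ : Fin n → β, (∏ x, w (σ x)) * (∑ x, f (σ x)) ^ 2
      = ∑ x, ∑ y, ∑ σ : Fin n → β, (∏ z, w (σ z)) * (f (σ x) * f (σ y)) := by
        have e : ∀ σ : Fin n → β, (∑ x, f (σ x)) ^ 2 = ∑ x, ∑ y, f (σ x) * f (σ y) :=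
          fun σ => by rw [sq, sum_mul_sum]
        simp only [e, mul_sum]
        rw [sum_comm]
        exact sum_congr rfl fun x _ => sum_comm
    _ = ∑ x, ∑ σ : Fin n → β, (∏ z, w (σ z)) * f (σ x) ^ 2 := by
        refine sum_congr rfl fun x _ => ?_
        rw [sum_eq_single x (fun y _ hy => hoff x y hy.symm) (by simp)]
        simp only [sq]
    _ ≤ ∑ _x : Fin n, ∑ σ : Fin n → β, (∏ z, w (σ z)) * B := by
        gcongr with x _ σ _
        · exact prod_nonneg fun z _ => hw _
        · exact hB _
    _ = n * B * ∑ σ : Fin n → β, ∏ x, w (σ x) := by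
        simp [← sum_mul]; ring

/-- Jensen's inequality for the exponential with unnormalized weights. -/
lemma mul_exp_le_sum_mul_exp {α : Type*} [Fintype α] (w N : α → ℝ) (hw : ∀ a, 0 ≤ w a)
    {K M : ℝ} (hK : 0 ≤ K) (hN : ∑ a, w a * N a ≤ M * ∑ a, w a) :
    (∑ a, w a) * Real.exp (-K * M) ≤ ∑ a, w a * Real.exp (-K * N a) := by
  -- The tangent line to the exponential at `-K * M`.
  have h1 : ∀ a, w a * (Real.exp (-K * M) * (1 + K * M - K * N a)) ≤ w a * Real.exp (-K * N a) := by
    intro a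
    refine mul_le_mul_of_nonneg_left ?_ (hw a)
    have h2 : -K * N a = -K * M + (K * M - K * N a) := by ring
    rw [h2, Real.exp_add]
    have := Real.add_one_le_exp (K * M - K * N a)
    gcongr
    linarith
  refine le_trans ?_ (sum_le_sum fun a _ => h1 a)
  have h3 : ∑ a, w a * (Real.exp (-K * M) * (1 + K * M - K * N a))
      = Real.exp (-K * M) * ((∑ a, w a) + K * (M * (∑ a, w a) - ∑ a, w a * N a)) := by
    simp only [mul_sub, mul_sum, ← sum_add_distrib, ← sum_sub_distrib]
    exact sum_congr rfl fun a _ => by ring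
  rw [h3, mul_comm]
  have := mul_nonneg hK (sub_nonneg.mpr hN)
  gcongr
  linarith

end Product

/-! ### Correcting the magnetization of one layer. -/

section Flip

lemma sum_spin_eq {n : ℕ} (s : Fin n → ℤˣ) :
    ∑ x, spin (s x) = 2 * ((univ.filter fun x => s x = 1).card : ℝ) - n := by
  have : ∀ x, spin (s x) = 2 * (if s x = 1 then 1 else 0) - 1 := fun x => by
    rcases Int.units_eq_one_or (s x) with h | h <;> norm_num [h, spin]
  simp only [this, sum_sub_distrib, ← mul_sum, sum_boole]
  simp

/-- The magnetization of a layer is corrected by flipping only the excess spins. -/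
lemma exists_spinDist_le {n : ℕ} (s : Fin n → ℤˣ) {k : ℕ} (hk : k ≤ n) :
    ∃ t : Fin n → ℤˣ, ∑ x, spin (t x) = 2 * (k : ℝ) - n ∧
      spinDist s t ≤ |∑ x, spin (s x) - (2 * (k : ℝ) - n)| / 2 := by
  classical
  set A : Finset (Fin n) := univ.filter fun x => s x = 1 with hA
  -- Nesting the sets of plus spins gives all flips the same sign, so the distance equals half the
  -- magnetization difference.
  obtain ⟨B, hBk, hAB⟩ : ∃ B : Finset (Fin n), B.card = k ∧ (A ⊆ B ∨ B ⊆ A) := by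
    rcases le_total A.card k with h | h
    · obtain ⟨B, h1, h2⟩ := exists_superset_card_eq h (by simpa using hk)
      exact ⟨B, h2, Or.inl h1⟩
    · obtain ⟨B, h1, h2⟩ := exists_subset_card_eq h
      exact ⟨B, h2, Or.inr h1⟩
  set t : Fin n → ℤˣ := fun x => if x ∈ B then 1 else -1 with ht
  have ht1 : ∀ x, t x = 1 ↔ x ∈ B := fun x => by
    by_cases hx : x ∈ B <;> simp [ht, hx]
  have htsum : ∑ x, spin (t x) = 2 * (k : ℝ) - n := by
    rw [sum_spin_eq]
    simp [ht1, hBk]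
  have sgn : ∀ u v : ℤˣ, (u = 1 → v = 1) → |spin u - spin v| = spin v - spin u := by
    intro u v hx
    rcases Int.units_eq_one_or u with rfl | rfl
    · simp [hx rfl]
    · rcases Int.units_eq_one_or v with rfl | rfl <;> norm_num [spin]
  refine ⟨t, htsum, ?_⟩
  rw [← htsum, spinDist, ← sum_div, ← sum_sub_distrib]
  gcongr
  rcases hAB with h | h
  · rw [sum_congr rfl fun x _ => sgn _ _ fun hx => (ht1 x).mpr (h (by simp [hA, hx])),
      sum_sub_distrib, sum_sub_distrib, abs_sub_comm]
    exact le_abs_self _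
  · rw [sum_congr rfl fun x _ => (abs_sub_comm _ _).trans
      (sgn _ _ fun hx => by simpa [hA] using h ((ht1 x).mp hx))]
    exact le_abs_self _

end Flip

/-! ### The square: comparing the field and constrained ensembles. -/

section Square

variable {ℓ : ℕ} [NeZero ℓ] {lam : ℝ} {h m : Fin ℓ → ℝ}

/-- The Gibbs weight of a configuration in the square: its columns are independent. -/
noncomputable def squareWeight (lam : ℝ) (h : Fin ℓ → ℝ) (σ : Fin ℓ → Fin ℓ → ℤˣ) : ℝ :=
  ∏ x, Real.exp (columnExponent lam h (σ x))

lemma squareWeight_pos (σ : Fin ℓ → Fin ℓ → ℤˣ) : 0 < squareWeight lam h σ :=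
  prod_pos fun _ _ => Real.exp_pos _

lemma squareWeight_eq (σ : Fin ℓ → Fin ℓ → ℤˣ) :
    squareWeight lam h σ = Real.exp (-Hvert lam σ + ∑ x, ∑ i, h i * spin (σ x i)) := by
  rw [squareWeight, ← Real.exp_sum, Hvert, ← sum_neg_distrib, ← sum_add_distrib]
  congr 1
  refine sum_congr rfl fun x _ => ?_
  rw [columnExponent, sum_add_distrib, neg_mul, neg_neg, mul_sum]
  simp only [mul_assoc]

lemma Zsquare_eq : Zsquare lam h = ∑ σ, squareWeight lam h σ := by
  simp only [Zsquare, squareWeight_eq]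

lemma Zsquare_pos : 0 < Zsquare lam h :=
  sum_pos (fun _ _ => Real.exp_pos _) univ_nonempty

lemma squareWeight_eq_of_constraint {σ : Fin ℓ → Fin ℓ → ℤˣ}
    (hσ : ∀ i, ∑ x, spin (σ x i) = (ℓ : ℝ) * m i) :
    squareWeight lam h σ = Real.exp (ℓ * ∑ i, h i * m i) * Real.exp (-Hvert lam σ) := by
  rw [squareWeight_eq, ← Real.exp_add, add_comm, sum_comm]
  simp only [← mul_sum, hσ]
  rw [mul_sum]
  congr 2
  exact sum_congr rfl fun i _ => by ring

open Classical in
lemma exp_mul_Zconstrained :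
    Real.exp (ℓ * ∑ i, h i * m i) * Zconstrained lam m
      = ∑ σ : Fin ℓ → Fin ℓ → ℤˣ,
          if ∀ i, ∑ x, spin (σ x i) = (ℓ : ℝ) * m i then squareWeight lam h σ else 0 := by
  rw [Zconstrained, mul_sum]
  refine sum_congr rfl fun σ _ => ?_
  split_ifs with hσ
  · rw [squareWeight_eq_of_constraint hσ]
  · simp

lemma exp_mul_Zconstrained_le :
    Real.exp (ℓ * ∑ i, h i * m i) * Zconstrained lam m ≤ Zsquare lam h := by
  rw [exp_mul_Zconstrained, Zsquare_eq]
  refine sum_le_sum fun σ _ => ?_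
  split_ifs
  · exact le_rfl
  · exact (squareWeight_pos σ).le

lemma squareWeight_mul_exp_le (hlam : 0 ≤ lam) {H : ℝ} (hH : ∀ i, |h i| ≤ H)
    (σ τ : Fin ℓ → Fin ℓ → ℤˣ) :
    squareWeight lam h σ * Real.exp (-(4 * lam + 2 * H) * ∑ x, spinDist (σ x) (τ x))
      ≤ squareWeight lam h τ := by
  rw [squareWeight, squareWeight, ← Real.exp_sum, ← Real.exp_sum, ← Real.exp_add,
    Real.exp_le_exp, mul_sum, ← sum_add_distrib]
  refine sum_le_sum fun x _ => ?_
  have := (abs_le.mp (abs_columnExponent_sub_le hlam hH (σ x) (τ x))).2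
  linarith

/-- The mean total deviation of the layer magnetizations is of order `ℓ ^ (3 / 2)`. -/
lemma sum_squareWeight_mul_deviation_le (hm : ∀ i, |m i| ≤ 1) (H : IsAssociatedField lam m h) :
    ∑ σ, squareWeight lam h σ * ∑ i, |∑ x, spin (σ x i) - ℓ * m i| / 2
      ≤ (5 / 4 * (ℓ * √ℓ)) * ∑ σ, squareWeight lam h σ := by
  rw [isAssociatedField_iff] at H
  have hl : (0 : ℝ) < √ℓ := Real.sqrt_pos.mpr (by exact_mod_cast Nat.pos_of_neZero ℓ)
  have hsq : √(ℓ : ℝ) * √ℓ = ℓ := Real.mul_self_sqrt (Nat.cast_nonneg _)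
  have hlayer : ∀ i, ∑ σ, squareWeight lam h σ * (|∑ x, spin (σ x i) - ℓ * m i| / 2)
      ≤ (5 / 4 * √ℓ) * ∑ σ, squareWeight lam h σ := by
    intro i
    have hvar := sum_prod_mul_sum_sq_le (n := ℓ) (fun b => Real.exp (columnExponent lam h b))
      (fun b => spin (b i) - m i) (fun _ => (Real.exp_pos _).le) (B := 4) (fun b => by
        have h1 := abs_le.mp (hm i)
        rcases spin_eq_one_or (b i) with h' | h' <;> rw [h'] <;> nlinarith) (H i)
    change ∑ σ, squareWeight lam h σ * (∑ x, (spin (σ x i) - m i)) ^ 2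
      ≤ ℓ * 4 * ∑ σ, squareWeight lam h σ at hvar
    have hpt : ∀ σ : Fin ℓ → Fin ℓ → ℤˣ,
        squareWeight lam h σ * (|∑ x, spin (σ x i) - ℓ * m i| / 2)
          ≤ (1 / (4 * √ℓ)) * (squareWeight lam h σ * (∑ x, (spin (σ x i) - m i)) ^ 2)
            + √ℓ / 4 * squareWeight lam h σ := by
      intro σ
      have e : ∑ x, (spin (σ x i) - m i) = ∑ x, spin (σ x i) - ℓ * m i := by simp
      rw [e]
      set S := ∑ x, spin (σ x i) - ℓ * m i
      -- The scale `√ℓ` balances the two terms: with second moment at most `4 * ℓ` they give `√ℓ +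
      -- √ℓ / 4`, the origin of `5 / 4`.
      have h1 : |S| / 2 ≤ 1 / (4 * √ℓ) * S ^ 2 + √ℓ / 4 := by
        have h2 : 1 / (4 * √ℓ) * S ^ 2 + √ℓ / 4 - |S| / 2 = (|S| - √ℓ) ^ 2 / (4 * √ℓ) := by
          rw [← sq_abs S]
          field_simp
          ring
        have h3 : 0 ≤ (|S| - √ℓ) ^ 2 / (4 * √ℓ) := by positivity
        linarith
      have := mul_le_mul_of_nonneg_left h1 (squareWeight_pos (lam := lam) (h := h) σ).le
      linarith
    refine (sum_le_sum fun σ _ => hpt σ).trans ?_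
    rw [sum_add_distrib, ← mul_sum, ← mul_sum]
    have h4 := mul_le_mul_of_nonneg_left hvar (show 0 ≤ 1 / (4 * √(ℓ : ℝ)) by positivity)
    have h5 : 1 / (4 * √(ℓ : ℝ)) * (ℓ * 4 * ∑ σ, squareWeight lam h σ)
        = √ℓ * ∑ σ, squareWeight lam h σ := by
      rw [div_mul_eq_mul_div, div_eq_iff (by positivity)]
      linear_combination (-4 * ∑ σ, squareWeight lam h σ) * hsq
    linarith
  simp only [mul_sum univ _ (squareWeight _ _ _)]
  rw [sum_comm]
  refine (sum_le_sum fun i _ => hlayer i).trans_eq ?_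
  simp only [sum_const, card_univ, Fintype.card_fin, nsmul_eq_mul]
  ring

/-- Every configuration can be corrected to the prescribed layer magnetizations by as many flips
as half its total deviation. -/
lemma exists_constraint_spinDist_le (hm : ∀ i, m i ∈ magValues ℓ) (σ : Fin ℓ → Fin ℓ → ℤˣ) :
    ∃ τ : Fin ℓ → Fin ℓ → ℤˣ, (∀ i, ∑ x, spin (τ x i) = (ℓ : ℝ) * m i) ∧
      ∑ x, spinDist (σ x) (τ x) ≤ ∑ i, |∑ x, spin (σ x i) - ℓ * m i| / 2 := by
  have hl : (ℓ : ℝ) ≠ 0 := NeZero.ne _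
  have hex : ∀ i, ∃ t : Fin ℓ → ℤˣ, ∑ x, spin (t x) = ℓ * m i ∧
      spinDist (fun x => σ x i) t ≤ |∑ x, spin (σ x i) - ℓ * m i| / 2 := by
    intro i
    obtain ⟨k, hk, hmk⟩ := hm i
    have e : (ℓ : ℝ) * m i = 2 * (k : ℝ) - ℓ := by rw [hmk]; field_simp; ring
    rw [e]
    exact exists_spinDist_le _ hk
  choose t ht1 ht2 using hex
  refine ⟨fun x i => t i x, ht1, ?_⟩
  simp only [spinDist]
  rw [sum_comm]
  exact sum_le_sum fun i _ => ht2 i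

/-- Each site contributes `1` if it agrees with `t` and `exp (-κ)` if not. This replaces counting
Hamming balls. -/
lemma sum_exp_neg_spinDist {n : ℕ} (κ : ℝ) (t : Fin n → ℤˣ) :
    ∑ s, Real.exp (-κ * spinDist s t) = (1 + Real.exp (-κ)) ^ n := by
  simp only [spinDist, mul_sum, Real.exp_sum]
  rw [← Fintype.prod_sum (fun i u => Real.exp (-κ * (|spin u - spin (t i)| / 2)))]
  have : ∀ v : ℤˣ, ∑ u, Real.exp (-κ * (|spin u - spin v| / 2)) = 1 + Real.exp (-κ) := by
    intro v
    rw [UnitsInt.univ, sum_pair (by decide)]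
    rcases Int.units_eq_one_or v with rfl | rfl <;> norm_num [spin, add_comm]
  simp only [this, prod_const, card_univ, Fintype.card_fin]

/-- Jensen turns the mean deviation into a lower bound for the sum of weights damped by `exp` of
minus a multiple of the deviation. The damping rate pays for both the energy of the flips and the
penalty `κ`. -/
lemma Zsquare_mul_exp_le (hlam : 0 ≤ lam) {B : ℝ} (hB : ∀ i, |h i| ≤ B)
    (hm : ∀ i, m i ∈ magValues ℓ) (hm1 : ∀ i, |m i| ≤ 1) (H : IsAssociatedField lam m h)
    {κ : ℝ} (hκ : 0 ≤ κ) :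
    Zsquare lam h * Real.exp (-(4 * lam + 2 * B + κ) * (5 / 4 * (ℓ * √ℓ)))
      ≤ (1 + Real.exp (-κ)) ^ (ℓ ^ 2) * (Real.exp (ℓ * ∑ i, h i * m i) * Zconstrained lam m) := by
  classical
  have hB0 : 0 ≤ B := (abs_nonneg _).trans (hB 0)
  have hJ := mul_exp_le_sum_mul_exp (squareWeight lam h)
    (fun σ => ∑ i, |∑ x, spin (σ x i) - ℓ * m i| / 2) (fun σ => (squareWeight_pos σ).le)
    (show 0 ≤ 4 * lam + 2 * B + κ by positivity) (sum_squareWeight_mul_deviation_le hm1 H)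
  rw [Zsquare_eq]
  refine hJ.trans ?_
  have hball : ∀ τ : Fin ℓ → Fin ℓ → ℤˣ,
      ∑ σ : Fin ℓ → Fin ℓ → ℤˣ, Real.exp (-κ * ∑ x, spinDist (σ x) (τ x))
        = (1 + Real.exp (-κ)) ^ (ℓ ^ 2) := by
    intro τ
    simp only [mul_sum, Real.exp_sum]
    rw [← Fintype.prod_sum (fun x s => Real.exp (-κ * spinDist s (τ x)))]
    simp only [sum_exp_neg_spinDist, prod_const, card_univ, Fintype.card_fin, ← pow_mul, sq]
  set c : (Fin ℓ → Fin ℓ → ℤˣ) → ℝ := fun τ =>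
    if ∀ i, ∑ x, spin (τ x i) = (ℓ : ℝ) * m i then squareWeight lam h τ else 0 with hc
  have hc0 : ∀ τ, 0 ≤ c τ := fun τ => by
    simp only [hc]
    split_ifs
    · exact (squareWeight_pos τ).le
    · exact le_rfl
  calc ∑ σ, squareWeight lam h σ
        * Real.exp (-(4 * lam + 2 * B + κ) * ∑ i, |∑ x, spin (σ x i) - ℓ * m i| / 2)
      -- The corrected configuration is one term of a sum over all `τ`; exchanging the sums accounts
      -- for the multiplicity of the correction.
      ≤ ∑ σ : Fin ℓ → Fin ℓ → ℤˣ, ∑ τ, c τ * Real.exp (-κ * ∑ x, spinDist (σ x) (τ x)) := by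
        refine sum_le_sum fun σ _ => ?_
        obtain ⟨τ, hτ, hd⟩ := exists_constraint_spinDist_le hm σ
        refine le_trans ?_ (single_le_sum
          (fun τ _ => mul_nonneg (hc0 τ) (Real.exp_pos _).le) (mem_univ τ))
        have hcτ : c τ = squareWeight lam h τ := if_pos hτ
        rw [hcτ]
        have h1 := squareWeight_mul_exp_le hlam hB σ τ
        calc _ ≤ squareWeight lam h σ
              * Real.exp (-(4 * lam + 2 * B + κ) * ∑ x, spinDist (σ x) (τ x)) := by
              refine mul_le_mul_of_nonneg_left (Real.exp_le_exp.mpr ?_) (squareWeight_pos σ).le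
              rw [neg_mul, neg_mul, neg_le_neg_iff]
              exact mul_le_mul_of_nonneg_left hd (by positivity)
          _ = squareWeight lam h σ * Real.exp (-(4 * lam + 2 * B) * ∑ x, spinDist (σ x) (τ x))
              * Real.exp (-κ * ∑ x, spinDist (σ x) (τ x)) := by
              rw [mul_assoc, ← Real.exp_add]
              congr 2
              ring
          _ ≤ _ := mul_le_mul_of_nonneg_right h1 (Real.exp_pos _).le
    _ = _ := by
        rw [sum_comm]
        simp only [← mul_sum, hball]
        rw [← sum_mul, exp_mul_Zconstrained, mul_comm]

/-- The logarithm of the probability of the constraint is at most of order `ℓ ^ (3 / 2) log ℓ`. -/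
lemma abs_log_sub_log_Zconstrained_le (hlam : 0 ≤ lam) {B : ℝ} (hB : ∀ i, |h i| ≤ B)
    (hm : ∀ i, m i ∈ magValues ℓ) (hm1 : ∀ i, |m i| ≤ 1) (H : IsAssociatedField lam m h) :
    |Real.log (Real.exp (-(ℓ : ℝ) * ∑ i, h i * m i) * Zsquare lam h)
        - Real.log (Zconstrained lam m)|
      ≤ 1 + (4 * lam + 2 * B + 2 * Real.log ℓ) * (5 / 4 * (ℓ * √ℓ)) := by
  have hl : (1 : ℝ) ≤ ℓ := by exact_mod_cast Nat.pos_of_neZero ℓ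
  have hl0 : (0 : ℝ) < ℓ := by linarith
  -- This `κ` gives `exp (-κ) = 1 / ℓ ^ 2`, so the entropy factor over `ℓ ^ 2` sites is at most `exp
  -- 1`.
  have h1 := Zsquare_mul_exp_le hlam hB hm hm1 H (κ := 2 * Real.log ℓ)
    (mul_nonneg two_pos.le (Real.log_nonneg hl))
  have h2 := exp_mul_Zconstrained_le (lam := lam) (h := h) (m := m)
  have hZ := Zsquare_pos (lam := lam) (h := h)
  have hpow : (1 + Real.exp (-(2 * Real.log (ℓ : ℝ)))) ^ (ℓ ^ 2) ≤ Real.exp 1 := by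
    have e : Real.exp (-(2 * Real.log (ℓ : ℝ))) = 1 / (ℓ : ℝ) ^ 2 := by
      rw [Real.exp_neg, two_mul, Real.exp_add, Real.exp_log hl0, sq, one_div]
    rw [e]
    calc (1 + 1 / (ℓ : ℝ) ^ 2) ^ (ℓ ^ 2) ≤ Real.exp (1 / (ℓ : ℝ) ^ 2) ^ (ℓ ^ 2) := by
          gcongr
          rw [add_comm]
          exact Real.add_one_le_exp _
      _ = Real.exp 1 := by
          rw [← Real.exp_nat_mul]
          congr 1
          push_cast
          field_simp
  have hC : 0 < Zconstrained lam m := by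
    have h3 : 0 < (1 + Real.exp (-(2 * Real.log (ℓ : ℝ)))) ^ (ℓ ^ 2)
        * (Real.exp (ℓ * ∑ i, h i * m i) * Zconstrained lam m) :=
      lt_of_lt_of_le (by positivity) h1
    rw [mul_pos_iff_of_pos_left (by positivity), mul_pos_iff_of_pos_left (Real.exp_pos _)] at h3
    exact h3
  have h4 := h1.trans (mul_le_mul_of_nonneg_right hpow (by positivity))
  have h5 := Real.log_le_log (by positivity) h4
  have h6 := Real.log_le_log (by positivity) h2
  rw [Real.log_mul (by positivity) (by positivity), Real.log_exp,
    Real.log_mul (by positivity) (by positivity), Real.log_exp,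
    Real.log_mul (by positivity) (by positivity), Real.log_exp] at h5
  rw [Real.log_mul (by positivity) (by positivity), Real.log_exp] at h6
  rw [Real.log_mul (by positivity) (by positivity), Real.log_exp, abs_of_nonneg (by linarith)]
  linarith

lemma abs_free_energy_sub_le (hlam : 0 ≤ lam) {B : ℝ} (hB : ∀ i, |h i| ≤ B)
    (hm : ∀ i, m i ∈ magValues ℓ) (hm1 : ∀ i, |m i| ≤ 1) (H : IsAssociatedField lam m h)
    {a : ℝ} (ha : 1 / 2 < a) :
    |1 / (ℓ : ℝ) ^ 2 *
        Real.log (Real.exp (-(ℓ : ℝ) * ∑ i, h i * m i) * Zsquare lam h) + phi lam m|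
      ≤ (1 + 5 / 4 * (4 * lam + 2 * B + 2 / (a - 1 / 2))) * (ℓ : ℝ) ^ (a - 1) := by
  have hl : (1 : ℝ) ≤ ℓ := by exact_mod_cast Nat.pos_of_neZero ℓ
  have hl0 : (0 : ℝ) < ℓ := by linarith
  have hB0 : 0 ≤ B := (abs_nonneg _).trans (hB 0)
  have ha' : 0 < a - 1 / 2 := by linarith
  have h1 := abs_log_sub_log_Zconstrained_le hlam hB hm hm1 H
  have e : ∀ x y : ℝ, 1 / (ℓ : ℝ) ^ 2 * x + -(1 / (ℓ : ℝ) ^ 2) * y = (x - y) / (ℓ : ℝ) ^ 2 :=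
    fun x y => by ring
  rw [phi, e, abs_div, abs_of_nonneg (sq_nonneg (ℓ : ℝ)), div_le_iff₀ (by positivity)]
  refine h1.trans ?_
  -- The margin `a - 1 / 2` absorbs the logarithm.
  have hlog : Real.log ℓ ≤ (ℓ : ℝ) ^ (a - 1 / 2) / (a - 1 / 2) :=
    Real.log_le_rpow_div hl0.le ha'
  have hone : 1 ≤ (ℓ : ℝ) ^ (a - 1 / 2) := Real.one_le_rpow hl ha'.le
  have hpow : (ℓ : ℝ) ^ (a - 1) * (ℓ : ℝ) ^ 2 = (ℓ : ℝ) ^ (a - 1 / 2) * (ℓ * √ℓ) := by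
    rw [Real.sqrt_eq_rpow, ← Real.rpow_natCast, ← Real.rpow_add hl0]
    nth_rewrite 3 [← Real.rpow_one (ℓ : ℝ)]
    rw [← Real.rpow_add hl0, ← Real.rpow_add hl0]
    congr 1
    push_cast
    ring
  rw [mul_assoc, hpow]
  have hs : 1 ≤ (ℓ : ℝ) * √ℓ := one_le_mul_of_one_le_of_one_le hl (Real.one_le_sqrt.mpr hl)
  set P := (ℓ : ℝ) ^ (a - 1 / 2)
  have h2 : 4 * lam + 2 * B + 2 * Real.log ℓ ≤ (4 * lam + 2 * B + 2 / (a - 1 / 2)) * P := by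
    have h3 : 4 * lam + 2 * B ≤ (4 * lam + 2 * B) * P :=
      le_mul_of_one_le_right (by positivity) hone
    have h4 : 2 / (a - 1 / 2) * P = 2 * (P / (a - 1 / 2)) := by ring
    linarith
  have h5 := mul_le_mul_of_nonneg_right h2 (show 0 ≤ 5 / 4 * ((ℓ : ℝ) * √ℓ) by positivity)
  have h6 := one_le_mul_of_one_le_of_one_le hone hs
  linarith

end Square

end LayerIsing

theorem mainTheorem7 (mplus : ℝ) (hmplus0 : 0 < mplus) (hmplus1 : mplus < 1) :
    ∃ lam₀ : ℝ, 0 < lam₀ ∧ ∀ lam : ℝ, 0 < lam → lam < lam₀ →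
      (∀ (ℓ : ℕ) [NeZero ℓ] (m : Fin ℓ → ℝ), (∀ i, |m i| ≤ mplus) →
        ∃! h : Fin ℓ → ℝ, LayerIsing.IsAssociatedField lam m h) ∧
      ∀ a : ℝ, 1 / 2 < a → a < 1 →
        ∃ c : ℝ, ∀ (ℓ : ℕ) [NeZero ℓ] (m h : Fin ℓ → ℝ),
          (∀ i, m i ∈ LayerIsing.magValues ℓ) → (∀ i, |m i| ≤ mplus) →
          LayerIsing.IsAssociatedField lam m h →
          |1 / (ℓ : ℝ) ^ 2 *
              Real.log (Real.exp (-(ℓ : ℝ) * ∑ i, h i * m i) * LayerIsing.Zsquare lam h)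
            + LayerIsing.phi lam m| ≤ c * (ℓ : ℝ) ^ (a - 1) := by
  -- The argument is not perturbative in `lam`, so the threshold `1` is an arbitrary choice.
  refine ⟨1, one_pos, fun lam hlam _ => ⟨fun ℓ _ m hm => ?_, fun a ha _ => ?_⟩⟩
  · obtain ⟨h, hh⟩ := LayerIsing.exists_isAssociatedField (lam := lam) hmplus1 hm
    exact ⟨h, hh, fun h' hh' => LayerIsing.isAssociatedField_unique hh hh'⟩
  · exact ⟨_, fun ℓ _ m h hmv hm H => LayerIsing.abs_free_energy_sub_le hlam.le
      (LayerIsing.abs_field_le hlam.le hmplus1 hm H) hmv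
      (fun i => (hm i).trans hmplus1.le) H ha⟩
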